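/- Let $\mathbb{K}$ be an algebraically closed field of characteristic $0$. A Hom-Lie algebra over $\mathbb K$ is a triple $(\mathfrak g,[\cdot,\cdot],\alpha)$ where $\mathfrak g$ is a $\mathbb K$-vector space, $[\cdot,\cdot]$ is a skew-symmetric bilinear bracket on $\mathfrak g$ and $\alpha$ is a linear endomorphism of $\mathfrak g$ with $[\alpha(x),[y,z]]+[\alpha(y),[z,x]]+[\alpha(z),[x,y]]=0$ for all $x,y,z$. An ideal is a subspace $I$ with $[I,\mathfrak g]\subseteq I$ and $\alpha(I)\subseteq I$; the Hom-Lie algebra is simple if its bracket is not identically zero and its only ideals are $\{0\}$ and $\mathfrak g$. (1) Let $(\mathfrak g,[\cdot,\cdot],\theta)$ be a simple Hom-Lie algebra such that $\theta^2=\mathrm{id}$ and $\theta([x,y])=[\theta(x),\theta(y)]$ for all $x,y$. Let $\mathfrak g_\theta$ be the Lie algebra with underlying space $\mathfrak g$ and bracket $[x,y]_\theta=[\theta(x),\theta(y)]$. Then either $\mathfrak g_\theta$ is a simple Lie algebra, or $\mathfrak g_\theta$ is not simple but semisimple, and $\mathfrak g_\theta=S\oplus\theta(S)$ for some ideal $S$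 of $\mathfrak g_\theta$ that is a simple Lie algebra, where $\theta(S)$ is an ideal of $\mathfrak g_\theta$ too. (2) In the situation of (1), assume that $\mathfrak g$ is finite-dimensional, and put $B(x,y)=\operatorname{tr}(\rho(x)\rho(y))$, where $\rho(x)=[x,\cdot\,]$. Then $B$ is a quadratic structure on $(\mathfrak g,[\cdot,\cdot],\theta)$, that is, a symmetric nondegenerate bilinear form with $B([x,y],z)=B(x,[y,z])$ and $B(\theta(x),y)=B(x,\theta(y))$ for all $x,y,z$. Moreover $B(x,y)=\mathcal K(\theta(x),y)$ for all $x,y$, where $\mathcal K$ is the Killing form of $\mathfrak g_\theta$. (3) Conversely, let $(L,[\cdot,\cdot])$ be a simple Lie algebra over $\mathbb K$ and $\theta$ an automorphism of $L$ with $\theta^2=\mathrm{id}$. Then $(L,\theta\circ[\cdot,\cdot],\theta)$ is a simple Hom-Lie algebra, and its twist map $\theta$ is an involution that preserves its bracket. -/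

import Mathlib

/-- A Hom-Lie algebra `(V, [·,·], α)` over a field `K`. -/
structure HomLieAlgebra (K V : Type*) [Field K] [AddCommGroup V] [Module K V] where
  /-- the bilinear bracket `[·,·]` -/
  bracket : V →ₗ[K] V →ₗ[K] V
  /-- the twist map `α` -/
  twist : V →ₗ[K] V
  skew : ∀ x y, bracket x y = - bracket y x
  hom_jacobi : ∀ x y z, bracket (twist x) (bracket y z) + bracket (twist y) (bracket z x)
    + bracket (twist z) (bracket x y) = 0

namespace HomLieAlgebra

section

variable {K V : Type*} [Field K] [AddCommGroup V] [Module K V]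

/-- `α [x, y] = [α x, α y]`. -/
def IsMultiplicative (g : HomLieAlgebra K V) : Prop :=
  ∀ x y, g.twist (g.bracket x y) = g.bracket (g.twist x) (g.twist y)

/-- `α² = id`. -/
def IsInvolutive (g : HomLieAlgebra K V) : Prop :=
  ∀ x, g.twist (g.twist x) = x

/-- A subspace `I` with `[I, V] ⊆ I` and `α(I) ⊆ I`. -/
def IsIdeal (g : HomLieAlgebra K V) (I : Submodule K V) : Prop :=
  (∀ x ∈ I, ∀ y, g.bracket x y ∈ I) ∧ ∀ x ∈ I, g.twist x ∈ I

/-- The bracket is not identically zero and the only ideals are `0` and the whole space. -/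
def IsSimple (g : HomLieAlgebra K V) : Prop :=
  (∃ x y, g.bracket x y ≠ 0) ∧ ∀ I : Submodule K V, g.IsIdeal I → I = ⊥ ∨ I = ⊤

/-- `B` is a quadratic structure on `g`: a symmetric nondegenerate bilinear form that is
invariant and for which the twist map is symmetric. -/
structure IsQuadratic (g : HomLieAlgebra K V) (B : LinearMap.BilinForm K V) : Prop where
  symm : ∀ x y, B x y = B y x
  nondegenerate : B.Nondegenerate
  invariant : ∀ x y z, B (g.bracket x y) z = B x (g.bracket y z)
  twist_symm : ∀ x y, B (g.twist x) y = B x (g.twist y)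

/-- The form `B(x, y) = tr (ρ(x) ρ(y))`, where `ρ(x) = [x, ·]`. -/
noncomputable def traceForm (g : HomLieAlgebra K V) : LinearMap.BilinForm K V :=
  ((LinearMap.mul K (Module.End K V)).compl₁₂ g.bracket g.bracket).compr₂ (LinearMap.trace K V)

theorem traceForm_apply (g : HomLieAlgebra K V) (x y : V) :
    g.traceForm x y = LinearMap.trace K V (g.bracket x ∘ₗ g.bracket y) := rfl

/-- The underlying space of the Lie algebra `g_θ` attached to an involutive multiplicative
Hom-Lie algebra `g = (V, [·,·], θ)`; it is `V` itself, with the bracket `[x, y]_θ = [θ x, θ y]`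
(which is `θ⁻¹ [x, y]`). -/
@[nolint unusedArguments]
def AssocLie (g : HomLieAlgebra K V) (_hm : g.IsMultiplicative) (_hi : g.IsInvolutive) : Type _ :=
  V

variable (g : HomLieAlgebra K V) (hm : g.IsMultiplicative) (hi : g.IsInvolutive)

instance : AddCommGroup (g.AssocLie hm hi) := inferInstanceAs (AddCommGroup V)

instance : Module K (g.AssocLie hm hi) := inferInstanceAs (Module K V)

/-- The identity map from `V` to the underlying space of `g_θ`. -/
def toAssocLie : V ≃ₗ[K] g.AssocLie hm hi := LinearEquiv.refl K V

/-- The map `θ`, regarded as a linear map on `g_θ`. -/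
def assocTwist : g.AssocLie hm hi →ₗ[K] g.AssocLie hm hi :=
  (g.toAssocLie hm hi).conj g.twist

instance : Bracket (g.AssocLie hm hi) (g.AssocLie hm hi) where
  bracket x y := g.toAssocLie hm hi (g.bracket (g.twist ((g.toAssocLie hm hi).symm x))
    (g.twist ((g.toAssocLie hm hi).symm y)))

theorem assocLie_lie_def (x y : g.AssocLie hm hi) :
    ⁅x, y⁆ = g.toAssocLie hm hi (g.bracket (g.twist ((g.toAssocLie hm hi).symm x))
      (g.twist ((g.toAssocLie hm hi).symm y))) := rfl

theorem assocLie_bracket (x y : V) :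
    ⁅g.toAssocLie hm hi x, g.toAssocLie hm hi y⁆ =
      g.toAssocLie hm hi (g.bracket (g.twist x) (g.twist y)) := rfl

instance [CharZero K] : LieRing (g.AssocLie hm hi) where
  add_lie x y z := by
    simp only [assocLie_lie_def, map_add, LinearMap.add_apply]
  lie_add x y z := by
    simp only [assocLie_lie_def, map_add]
  lie_self x := by
    have h : (2 : K) • g.bracket (g.twist x) (g.twist x) = 0 := by
      rw [two_smul]
      exact add_eq_zero_iff_eq_neg.mpr (g.skew _ _)
    exact (smul_eq_zero.mp h).resolve_left two_ne_zero
  leibniz_lie x y z := by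
    change g.bracket (g.twist x) (g.twist (g.bracket (g.twist y) (g.twist z))) =
      g.bracket (g.twist (g.bracket (g.twist x) (g.twist y))) (g.twist z) +
      g.bracket (g.twist y) (g.twist (g.bracket (g.twist x) (g.twist z)))
    have e : ∀ a b : V, g.twist (g.bracket (g.twist a) (g.twist b)) = g.bracket a b := by
      intro a b
      rw [hm, hi, hi]
    rw [e y z, e x y, e x z]
    have h := g.hom_jacobi x y z
    rw [g.skew z x, map_neg, g.skew (g.twist z)] at h
    have h' : g.bracket (g.twist x) (g.bracket y z) -
        (g.bracket (g.bracket x y) (g.twist z) + g.bracket (g.twist y) (g.bracket x z)) = 0 := by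
      rw [← h]
      abel
    exact sub_eq_zero.mp h'

instance [CharZero K] : LieAlgebra K (g.AssocLie hm hi) where
  lie_smul t x y := by
    simp only [assocLie_lie_def, map_smul]

end

/-- The Hom-Lie algebra `(L, θ ∘ [·,·], θ)` obtained from a Lie algebra `L` and an
endomorphism `θ` of `L` by composition. -/
def ofLie {K L : Type*} [Field K] [LieRing L] [LieAlgebra K L] (θ : L →ₗ⁅K⁆ L) :
    HomLieAlgebra K L where
  bracket := (LieModule.toEnd K L L : L →ₗ[K] Module.End K L).compr₂ (θ : L →ₗ[K] L)
  twist := θ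
  skew x y := by
    change θ ⁅x, y⁆ = - θ ⁅y, x⁆
    rw [← lie_skew, map_neg]
  hom_jacobi x y z := by
    change θ ⁅θ x, θ ⁅y, z⁆⁆ + θ ⁅θ y, θ ⁅z, x⁆⁆ + θ ⁅θ z, θ ⁅x, y⁆⁆ = 0
    simp only [← LieHom.map_lie, ← map_add, lie_jacobi, map_zero]

theorem ofLie_bracket {K L : Type*} [Field K] [LieRing L] [LieAlgebra K L] (θ : L →ₗ⁅K⁆ L)
    (x y : L) : (ofLie θ).bracket x y = θ ⁅x, y⁆ := rfl

end HomLieAlgebra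

namespace LieAlgebra

section InvolutionSimple

variable {K L : Type*} [CommRing K] [LieRing L] [LieAlgebra K L] {θ : L ≃ₗ⁅K⁆ L}

/-! Since `[x, y] = [θ x, θ y]_θ`, a `θ`-stable ideal of `g_θ` is a Hom-ideal of `g`. So simplicity
of `g` makes `g_θ` a nonabelian Lie algebra without proper nonzero `θ`-stable ideals. For a proper
nonzero ideal `I`, both `I ∩ θ(I)` and `I + θ(I)` are `θ`-stable, whence `g_θ = I ⊕ θ(I)`; here
`θ(I)` is written as a comap, `θ` being its own inverse. Every such `I` is minimal and nonabelian,
and `I`, `θ(I)` are the only minimal ideals, which gives semisimplicity.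

For the trace form, `ρ(x) = ad(θ x) ∘ θ` turns `B` into the Killing form twisted by `θ`,
nondegenerate by Cartan's criterion. -/

theorem isLieAbelian_of_isCompl {I J : LieIdeal K L} (h : IsCompl I J)
    (hI : ∀ x ∈ I, ∀ y ∈ I, ⁅x, y⁆ = 0) (hJ : ∀ x ∈ J, ∀ y ∈ J, ⁅x, y⁆ = 0) :
    IsLieAbelian L := by
  have hIJ : ∀ x ∈ I, ∀ y ∈ J, ⁅x, y⁆ = 0 := fun x hx y hy =>
    (LieSubmodule.mem_bot _).mp <| h.inf_eq_bot.le
      ⟨lie_mem_left K L I x y hx, lie_mem_right K L J x y hy⟩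
  have hsum : ∀ x : L, ∃ a ∈ I, ∃ b ∈ J, a + b = x := fun x =>
    (LieSubmodule.mem_sup _ _ _).mp (h.sup_eq_top ▸ LieSubmodule.mem_top x)
  refine ⟨fun x y => ?_⟩
  obtain ⟨a, ha, b, hb, rfl⟩ := hsum x
  obtain ⟨c, hc, d, hd, rfl⟩ := hsum y
  rw [add_lie, lie_add, lie_add, hI a ha c hc, hIJ a ha d hd, hJ b hb d hd, ← lie_skew,
    hIJ c hc b hb]
  simp

variable (hθ : ∀ x, θ (θ x) = x) (hL : ¬ IsLieAbelian L)
  (hstable : ∀ I : LieIdeal K L, (∀ x ∈ I, θ x ∈ I) → I = ⊥ ∨ I = ⊤)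

include hθ hstable in
/-- If the only ideals stable under the involution `θ` are trivial, then a proper nonzero ideal
is a complement of its image under `θ`. -/
theorem isCompl_comap_involution {I : LieIdeal K L} (hbot : I ≠ ⊥) (htop : I ≠ ⊤) :
    IsCompl I (I.comap θ.toLieHom) := by
  have hmem : ∀ x, x ∈ I.comap θ.toLieHom ↔ θ x ∈ I := fun x => LieIdeal.mem_comap
  refine IsCompl.of_eq ?_ ?_
  · refine (hstable _ fun x hx => ?_).resolve_right fun h => htop (top_le_iff.mp (h ▸ inf_le_left))
    exact ⟨(hmem x).mp hx.2, (hmem _).mpr ((hθ x).symm ▸ hx.1)⟩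
  · refine (hstable _ fun x hx => ?_).resolve_left fun h => hbot (le_bot_iff.mp (h ▸ le_sup_left))
    obtain ⟨a, ha, b, hb, rfl⟩ := (LieSubmodule.mem_sup _ _ _).mp hx
    refine (LieSubmodule.mem_sup _ _ _).mpr
      ⟨θ b, (hmem b).mp hb, θ a, (hmem _).mpr ((hθ a).symm ▸ ha), ?_⟩
    rw [map_add, add_comm]

include hθ hstable in
-- A nonzero `J < I` also satisfies `L = J ⊕ θ(J)`. The `θ(J)`-component of an element of `I` lies
-- in `I ∩ θ(I) = 0`, so `I ≤ J`.
theorem isAtom_of_involution {I : LieIdeal K L} (hbot : I ≠ ⊥) (htop : I ≠ ⊤) : IsAtom I := by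
  refine ⟨hbot, fun J hJ => by_contra fun hJbot => hJ.not_ge fun x hx => ?_⟩
  have hJc := isCompl_comap_involution hθ hstable hJbot (hJ.trans_le le_top).ne
  have hIc := isCompl_comap_involution hθ hstable hbot htop
  obtain ⟨a, ha, b, hb, rfl⟩ :=
    (LieSubmodule.mem_sup _ _ _).mp (hJc.sup_eq_top ▸ LieSubmodule.mem_top x)
  have hbI : b ∈ I := (add_mem_cancel_left (hJ.le ha)).mp hx
  have hb' : b ∈ I.comap θ.toLieHom := LieIdeal.mem_comap.mpr (hJ.le (LieIdeal.mem_comap.mp hb))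
  rw [(LieSubmodule.mem_bot b).mp (hIc.inf_eq_bot.le ⟨hbI, hb'⟩), add_zero]
  exact ha

include hθ hL hstable in
-- If a proper `I` were abelian, so would be `θ(I)`, and then `L = I ⊕ θ(I)`.
theorem not_isLieAbelian_of_involution {I : LieIdeal K L} (hbot : I ≠ ⊥) :
    ¬ IsLieAbelian I := by
  intro hI
  have hI0 : ∀ x ∈ I, ∀ y ∈ I, ⁅x, y⁆ = 0 := fun x hx y hy =>
    congrArg Subtype.val (trivial_lie_zero I I ⟨x, hx⟩ ⟨y, hy⟩)
  by_cases htop : I = ⊤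
  · exact hL ⟨fun x y => hI0 x (htop ▸ LieSubmodule.mem_top x) y (htop ▸ LieSubmodule.mem_top y)⟩
  · refine hL (isLieAbelian_of_isCompl (isCompl_comap_involution hθ hstable hbot htop) hI0 ?_)
    intro x hx y hy
    have h : ⁅θ x, θ y⁆ = 0 := hI0 _ (LieIdeal.mem_comap.mp hx) _ (LieIdeal.mem_comap.mp hy)
    rw [← hθ ⁅x, y⁆, LieEquiv.map_lie, h, map_zero]

include hL hstable in
theorem center_eq_bot_of_involution : center K L = ⊥ := by
  refine (hstable _ fun x hx => ?_).resolve_right fun h =>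
    hL ((isLieAbelian_iff_center_eq_top K L).mpr h)
  rw [LieModule.mem_maxTrivSubmodule] at hx ⊢
  intro y
  rw [← θ.apply_symm_apply y, ← LieEquiv.map_lie, hx, map_zero]

include hθ hL hstable in
-- A third minimal ideal would meet `I` and `θ(I)` trivially, hence commute with both and be
-- central; but the center is `θ`-stable, so it vanishes.
theorem isAtom_iff_of_involution {I : LieIdeal K L} (hbot : I ≠ ⊥) (htop : I ≠ ⊤)
    (A : LieIdeal K L) : IsAtom A ↔ A = I ∨ A = I.comap θ.toLieHom := by
  have hc := isCompl_comap_involution hθ hstable hbot htop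
  have hI := isAtom_of_involution hθ hstable hbot htop
  have hI' : IsAtom (I.comap θ.toLieHom) :=
    isAtom_of_involution hθ hstable (fun h => htop (by simpa [h] using hc.sup_eq_top))
      (fun h => hbot (by simpa [h] using hc.inf_eq_bot))
  refine ⟨fun hA => ?_, by rintro (rfl | rfl) <;> assumption⟩
  by_contra! hne
  have h₁ := (hA.disjoint_of_ne hI hne.1).eq_bot
  have h₂ := (hA.disjoint_of_ne hI' hne.2).eq_bot
  refine hA.1 (le_bot_iff.mp ?_)
  rw [← center_eq_bot_of_involution hL hstable]
  intro x hx
  rw [LieModule.mem_maxTrivSubmodule]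
  intro y
  obtain ⟨a, ha, b, hb, rfl⟩ :=
    (LieSubmodule.mem_sup _ _ _).mp (hc.sup_eq_top ▸ LieSubmodule.mem_top y)
  rw [add_lie,
    (LieSubmodule.mem_bot _).mp (h₁.le ⟨lie_mem_right K L A a x hx, lie_mem_left K L I a x ha⟩),
    (LieSubmodule.mem_bot _).mp (h₂.le ⟨lie_mem_right K L A b x hx, lie_mem_left K L _ b x hb⟩),
    add_zero]

include hθ hL hstable in
theorem isSemisimple_of_involution {I : LieIdeal K L} (hbot : I ≠ ⊥) (htop : I ≠ ⊤) :
    IsSemisimple K L := by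
  have hc := isCompl_comap_involution hθ hstable hbot htop
  have hatoms : {A : LieIdeal K L | IsAtom A} = {I, I.comap θ.toLieHom} :=
    Set.ext (isAtom_iff_of_involution hθ hL hstable hbot htop)
  refine ⟨?_, ?_, fun A hA => not_isLieAbelian_of_involution hθ hL hstable hA.1⟩
  · rw [hatoms, sSup_pair, hc.sup_eq_top]
  · have hne : I ≠ I.comap θ.toLieHom := fun h => hbot (by
      have := hc.inf_eq_bot
      rwa [← h, inf_idem] at this)
    rw [hatoms, sSupIndep_pair hne]
    exact hc.disjoint

include hθ hL hstable in
theorem isSimple_or_isSemisimple_of_involution :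
    IsSimple K L ∨ (¬ IsSimple K L ∧ IsSemisimple K L ∧
      ∃ S T : LieIdeal K L, IsSimple K S ∧
        T.toSubmodule = S.toSubmodule.map (θ : L →ₗ[K] L) ∧
        IsCompl S.toSubmodule T.toSubmodule) := by
  refine or_iff_not_imp_left.mpr fun hs => ⟨hs, ?_⟩
  obtain ⟨I, hbot, htop⟩ : ∃ I : LieIdeal K L, I ≠ ⊥ ∧ I ≠ ⊤ := by
    by_contra! h
    exact hs ⟨fun I => or_iff_not_imp_left.mpr (h I), hL⟩
  have hss := isSemisimple_of_involution hθ hL hstable hbot htop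
  refine ⟨hss, I, I.comap θ.toLieHom,
    IsSemisimple.isSimple_of_isAtom I (isAtom_of_involution hθ hstable hbot htop), ?_,
    (LieSubmodule.isCompl_toSubmodule).mpr (isCompl_comap_involution hθ hstable hbot htop)⟩
  ext x
  refine ⟨fun hx => ⟨θ x, LieIdeal.mem_comap.mp hx, hθ x⟩, ?_⟩
  rintro ⟨y, hy, rfl⟩
  exact LieIdeal.mem_comap.mpr ((hθ y).symm ▸ hy :)

include hθ hL hstable in
theorem hasTrivialRadical_of_involution : HasTrivialRadical K L :=
  (hasTrivialRadical_iff_no_abelian_ideals K L).mpr fun _ hI => by_contra fun hbot =>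
    not_isLieAbelian_of_involution hθ hL hstable hbot hI

end InvolutionSimple

end LieAlgebra

namespace HomLieAlgebra

section

variable {K V : Type*} [Field K] [AddCommGroup V] [Module K V]
  (g : HomLieAlgebra K V) (hm : g.IsMultiplicative) (hi : g.IsInvolutive)

variable {g} in
theorem not_isLieAbelian_assocLie (hs : g.IsSimple) : ¬ IsLieAbelian (g.AssocLie hm hi) := by
  intro h
  obtain ⟨x, y, hxy⟩ := hs.1
  have h0 : g.bracket (g.twist (g.twist x)) (g.twist (g.twist y)) = 0 :=
    h.trivial (g.toAssocLie hm hi (g.twist x)) (g.toAssocLie hm hi (g.twist y))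
  rw [hi, hi] at h0
  exact hxy h0

variable [CharZero K]

/-- The twist map of an involutive multiplicative Hom-Lie algebra, as an automorphism of the
associated Lie algebra. -/
def assocTwistEquiv : g.AssocLie hm hi ≃ₗ⁅K⁆ g.AssocLie hm hi where
  __ := g.assocTwist hm hi
  map_lie' {x y} := hm (g.twist x) (g.twist y)
  invFun := g.assocTwist hm hi
  left_inv x := hi x
  right_inv x := hi x

theorem assocTwistEquiv_apply (x : V) :
    g.assocTwistEquiv hm hi (g.toAssocLie hm hi x) = g.toAssocLie hm hi (g.twist x) := rfl

theorem assocTwistEquiv_involutive (x : g.AssocLie hm hi) :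
    g.assocTwistEquiv hm hi (g.assocTwistEquiv hm hi x) = x := hi x

variable {g}

theorem eq_bot_or_eq_top_of_assocTwist_mem (hs : g.IsSimple) (I : LieIdeal K (g.AssocLie hm hi))
    (hI : ∀ x ∈ I, g.assocTwistEquiv hm hi x ∈ I) : I = ⊥ ∨ I = ⊤ := by
  have hideal : g.IsIdeal (I.toSubmodule.comap (g.toAssocLie hm hi).toLinearMap) := by
    refine ⟨fun x hx y => ?_, fun x hx => hI _ hx⟩
    have h : ⁅g.toAssocLie hm hi (g.twist x), g.toAssocLie hm hi (g.twist y)⁆ ∈ I :=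
      lie_mem_left K _ I _ _ (hI _ hx)
    rwa [assocLie_bracket, hi, hi] at h
  refine (hs.2 _ hideal).imp (fun h => ?_) (fun h => ?_)
  · refine (LieSubmodule.eq_bot_iff _).mpr fun x hx => ?_
    exact (Submodule.eq_bot_iff _).mp h ((g.toAssocLie hm hi).symm x) hx
  · refine eq_top_iff.mpr fun x _ => ?_
    exact Submodule.eq_top_iff'.mp h ((g.toAssocLie hm hi).symm x)

variable (g)

theorem traceForm_eq_killingForm (x y : V) :
    g.traceForm x y = killingForm K (g.AssocLie hm hi)
      (g.toAssocLie hm hi (g.twist x)) (g.toAssocLie hm hi y) := by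
  have h : (g.toAssocLie hm hi).conj (g.bracket x ∘ₗ g.bracket y) =
      LieAlgebra.ad K (g.AssocLie hm hi) (g.toAssocLie hm hi (g.twist x)) ∘ₗ
        LieAlgebra.ad K (g.AssocLie hm hi) (g.toAssocLie hm hi y) := by
    refine LinearMap.ext fun w => ?_
    obtain ⟨z, rfl⟩ := (g.toAssocLie hm hi).surjective w
    change g.bracket x (g.bracket y z) =
      g.bracket (g.twist (g.twist x)) (g.twist (g.bracket (g.twist y) (g.twist z)))
    rw [hm, hi, hi, hi]
  rw [traceForm_apply, killingForm_apply_apply, ← h, LinearMap.trace_conj']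

theorem killingForm_twist (x y : V) :
    killingForm K (g.AssocLie hm hi) (g.toAssocLie hm hi (g.twist x)) (g.toAssocLie hm hi y) =
      killingForm K (g.AssocLie hm hi) (g.toAssocLie hm hi x)
        (g.toAssocLie hm hi (g.twist y)) := by
  rw [← LieAlgebra.killingForm_of_equiv_apply (g.assocTwistEquiv hm hi), assocTwistEquiv_apply,
    assocTwistEquiv_apply, hi]

variable {g} in
include hm hi in
theorem traceForm_isQuadratic [FiniteDimensional K V] (hs : g.IsSimple) :
    g.IsQuadratic g.traceForm := by
  have hfin : FiniteDimensional K (g.AssocLie hm hi) := ‹FiniteDimensional K V›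
  have hrad : LieAlgebra.HasTrivialRadical K (g.AssocLie hm hi) :=
    LieAlgebra.hasTrivialRadical_of_involution (g.assocTwistEquiv_involutive hm hi)
      (not_isLieAbelian_assocLie hm hi hs) (eq_bot_or_eq_top_of_assocTwist_mem hm hi hs)
  have hsymm : ∀ x y, g.traceForm x y = g.traceForm y x := fun x y => by
    rw [traceForm_apply, traceForm_apply, LinearMap.trace_comp_comm']
  have hB := g.traceForm_eq_killingForm hm hi
  have htwist : ∀ x y, g.twist (g.bracket x y) = g.bracket (g.twist x) (g.twist y) := hm
  refine ⟨hsymm, ?_, fun x y z => ?_, fun x y => ?_⟩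
  · have hleft : ∀ x, (∀ y, g.traceForm x y = 0) → x = 0 := fun x hx => by
      -- Cartan's criterion enters through instance inference: trivial radical gives `IsKilling`.
      have h0 : g.twist x = 0 :=
        (LieAlgebra.IsKilling.killingForm_nondegenerate K (g.AssocLie hm hi)).1
          (g.toAssocLie hm hi (g.twist x)) fun y =>
            (hB x ((g.toAssocLie hm hi).symm y)).symm.trans (hx _)
      rw [← hi x, h0, map_zero]
    exact ⟨hleft, fun y hy => hleft y fun x => (hsymm y x).trans (hy x)⟩
  -- Moving `θ` across the Killing form reduces the claim to invariance of that form under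
  -- `[·,·]_θ`.
  · rw [hB, hB, htwist, killingForm_twist, htwist, ← assocLie_bracket, ← assocLie_bracket]
    exact LieModule.traceForm_apply_lie_apply K _ _ _ _ _
  · rw [hB, hB, killingForm_twist]

end

theorem ofLie_isSimple {K L : Type*} [Field K] [LieRing L] [LieAlgebra K L] (θ : L ≃ₗ⁅K⁆ L)
    (hL : LieAlgebra.IsSimple K L) (hθ : ∀ x, θ (θ x) = x) :
    (ofLie (K := K) θ.toLieHom).IsSimple := by
  refine ⟨?_, fun I hI => ?_⟩
  · by_contra! h
    exact hL.non_abelian ⟨fun x y => θ.injective ((h x y).trans (map_zero θ).symm)⟩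
  · let J : LieIdeal K L :=
      { I with
        lie_mem := fun {x m} hm => by
          -- Stability under the twist undoes the `θ` in the twisted bracket, so a Hom-ideal is an
          -- ideal of `L`.
          have h : θ (θ ⁅m, x⁆) ∈ I := hI.2 _ (hI.1 m hm x)
          rw [hθ, ← lie_skew] at h
          exact neg_mem_iff.mp h }
    exact (hL.eq_bot_or_eq_top J).imp (congrArg LieSubmodule.toSubmodule)
      (congrArg LieSubmodule.toSubmodule)

end HomLieAlgebra

theorem mainTheorem4 {K : Type*} [Field K] [IsAlgClosed K] [CharZero K] :
    (∀ (V : Type*) [AddCommGroup V] [Module K V] (g : HomLieAlgebra K V)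
      (hm : g.IsMultiplicative) (hi : g.IsInvolutive), g.IsSimple →
      (LieAlgebra.IsSimple K (g.AssocLie hm hi) ∨
        (¬ LieAlgebra.IsSimple K (g.AssocLie hm hi) ∧
          LieAlgebra.IsSemisimple K (g.AssocLie hm hi) ∧
          ∃ S T : LieIdeal K (g.AssocLie hm hi), LieAlgebra.IsSimple K S ∧
            T.toSubmodule = S.toSubmodule.map (g.assocTwist hm hi) ∧
            IsCompl S.toSubmodule T.toSubmodule)) ∧
      (FiniteDimensional K V →
        g.IsQuadratic g.traceForm ∧
        ∀ x y : V, g.traceForm x y =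
          killingForm K (g.AssocLie hm hi)
            (g.toAssocLie hm hi (g.twist x)) (g.toAssocLie hm hi y))) ∧
    (∀ (L : Type*) [LieRing L] [LieAlgebra K L] (θ : L ≃ₗ⁅K⁆ L),
      LieAlgebra.IsSimple K L → (∀ x, θ (θ x) = x) →
      (HomLieAlgebra.ofLie (K := K) θ.toLieHom).IsMultiplicative ∧
      (HomLieAlgebra.ofLie (K := K) θ.toLieHom).IsInvolutive ∧
      (HomLieAlgebra.ofLie (K := K) θ.toLieHom).IsSimple) := by
  refine ⟨fun V _ _ g hm hi hs => ⟨?_, fun _ => ⟨HomLieAlgebra.traceForm_isQuadratic hm hi hs,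
    g.traceForm_eq_killingForm hm hi⟩⟩, fun L _ _ θ hL hθ => ⟨fun x y => ?_, hθ,
    HomLieAlgebra.ofLie_isSimple θ hL hθ⟩⟩
  · exact LieAlgebra.isSimple_or_isSemisimple_of_involution
      (g.assocTwistEquiv_involutive hm hi) (HomLieAlgebra.not_isLieAbelian_assocLie hm hi hs)
      (HomLieAlgebra.eq_bot_or_eq_top_of_assocTwist_mem hm hi hs)
  · exact congrArg θ (LieEquiv.map_lie θ x y)
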